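/- Let $f\in\mathbb{Q}[[x_1,x_2]]$ be a power series with $f(0,0)=0$ (for instance, the Taylor series at the origin of a real-analytic function with rational coefficients), written as $$f(x_1,x_2)=U(x_1,x_2)\,x_1^{\nu_1}x_2^{\nu_2}F(x_1,x_2),\qquad F(x_1,x_2)=x_2^m+g_1(x_1)x_2^{m-1}+\cdots+g_m(x_1),$$ where $U\in\mathbb{Q}[[x_1,x_2]]$, $U(0,0)\neq0$, $\nu_1,\nu_2,m\ge 0$ are integers, $g_j\in\mathbb{Q}[[x_1]]$ and $g_j(0)=0$ for $1\le j\le m$, and $F(x_1,0)\ne0$ (that is, $g_m\neq 0$ if $m\ge1$). Consider the roots $r(x_1)$ of $F(x_1,\cdot)$, counted with multiplicity, in the ring of Puiseux series in $x_1$ (series with rational exponents that are bounded below and have a common denominator) over the algebraic closure $\overline{\mathbb{Q}}$ of $\mathbb{Q}$. Each root is nonzero, so $r(x_1)=c\,x_1^{a}+(\text{terms of higher order})$ with $c\ne0$, and $a$ is called its leading exponent. Let $a_1<\cdots<a_n$ be the distinct leading exponents of the roots, and let $N\left[\begin{smallmatrix}\cdot\\ \mu\end{smallmatrix}\right]$ be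 the number of roots, counted with multiplicity, with leading exponent $a_\mu$. For $0\le l\le n$ put $$A_l=\nu_1+\sum_{1\le\mu\le l}a_\mu N\left[\begin{smallmatrix}\cdot\\ \mu\end{smallmatrix}\right],\qquad B_l=\nu_2+\sum_{l+1\le\mu\le n}N\left[\begin{smallmatrix}\cdot\\ \mu\end{smallmatrix}\right].$$ Let the Newton polyhedron of $f$ be the convex hull in $\mathbb{R}^2$ of the union of all quadrants $(j,k)+[0,\infty)^2$, where $(j,k)\in\mathbb{N}^2\setminus\{(0,0)\}$ and the coefficient of $x_1^jx_2^k$ in $f$ is not zero. Then the points $(A_l,B_l)$, $0\le l\le n$, are pairwise distinct, and they are exactly the vertices (extreme points) of the Newton polyhedron of $f$. -/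

import Mathlib

/-- The ring of (formal) Puiseux series in one variable with coefficients in `K`: the series
`∑ c_q x ^ q` with rational exponents `q` whose support is well ordered (as in every Hahn series) and
has a common denominator. -/
def puiseuxSeries (K : Type*) [Field K] : Subring (HahnSeries ℚ K) where
  carrier := {s | ∃ N : ℕ, 0 < N ∧ ∀ q ∈ s.support, ∃ k : ℤ, q * N = k}
  zero_mem' := ⟨1, one_pos, by simp⟩
  one_mem' := by
    refine ⟨1, one_pos, fun q hq => ⟨0, ?_⟩⟩
    have h : q = 0 := by simpa using hq
    simp [h]
  add_mem' := by
    rintro s t ⟨M, hM, hs⟩ ⟨N, hN, ht⟩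
    refine ⟨M * N, Nat.mul_pos hM hN, fun q hq => ?_⟩
    rcases HahnSeries.support_add_subset _ _ hq with h | h
    · obtain ⟨k, hk⟩ := hs q h
      exact ⟨k * N, by push_cast; rw [← hk]; ring⟩
    · obtain ⟨k, hk⟩ := ht q h
      exact ⟨k * M, by push_cast; rw [← hk]; ring⟩
  neg_mem' := by
    rintro s ⟨M, hM, hs⟩
    exact ⟨M, hM, fun q hq => hs q (by simpa using hq)⟩
  mul_mem' := by
    rintro s t ⟨M, hM, hs⟩ ⟨N, hN, ht⟩
    refine ⟨M * N, Nat.mul_pos hM hN, fun q hq => ?_⟩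
    obtain ⟨u, hu, v, hv, rfl⟩ := Set.mem_add.mp (HahnSeries.support_mul_subset hq)
    obtain ⟨k, hk⟩ := hs u hu
    obtain ⟨l, hl⟩ := ht v hv
    exact ⟨k * N + l * M, by push_cast; rw [← hk, ← hl]; ring⟩

theorem ofPowerSeries_mem_puiseuxSeries (K : Type*) [Field K] (g : PowerSeries K) :
    HahnSeries.ofPowerSeries ℚ K g ∈ puiseuxSeries K := by
  refine ⟨1, one_pos, fun q hq => ?_⟩
  by_contra h
  refine hq ?_
  rw [HahnSeries.ofPowerSeries_apply]
  refine HahnSeries.embDomain_of_notMem_range ?_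
  rintro ⟨n, rfl⟩
  exact h ⟨n, by simp⟩

/-- A power series `g(x₁)` with rational coefficients, regarded as a Puiseux series in `x₁` with
coefficients in the algebraic closure of `ℚ`. -/
noncomputable def toPuiseux : PowerSeries ℚ →+* puiseuxSeries (AlgebraicClosure ℚ) :=
  ((HahnSeries.ofPowerSeries ℚ (AlgebraicClosure ℚ)).codRestrict
    (puiseuxSeries (AlgebraicClosure ℚ))
    (ofPowerSeries_mem_puiseuxSeries (AlgebraicClosure ℚ))).comp
    (PowerSeries.map (algebraMap ℚ (AlgebraicClosure ℚ)))

/-- `F = x₂ ^ m + g₁(x₁) x₂ ^ (m - 1) + ⋯ + g_m(x₁)` with `g_j(0) = 0` for all `j`;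
the variable of the polynomial is `x₂`, that of its coefficients is `x₁`. -/
def IsWeierstrassPolynomial (F : Polynomial (PowerSeries ℚ)) : Prop :=
  F.Monic ∧ ∀ j < F.natDegree, PowerSeries.constantCoeff (F.coeff j) = 0

/-- `F(x₁, x₂) = ∑ F_k(x₁) x₂ ^ k` as a power series in two variables; variable `0` is `x₁` and
variable `1` is `x₂`. -/
noncomputable def toTwoVariables (F : Polynomial (PowerSeries ℚ)) : MvPowerSeries (Fin 2) ℚ :=
  fun d => PowerSeries.coeff (d 0) (F.coeff (d 1))

/-- The roots `r(x₁)` of `F(x₁, x₂)`, as Puiseux series, counted with multiplicity. -/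
noncomputable def puiseuxRoots (F : Polynomial (PowerSeries ℚ)) :
    Multiset (puiseuxSeries (AlgebraicClosure ℚ)) :=
  (F.map toPuiseux).roots

/-- The leading exponent `a` of a nonzero Puiseux series `c x ^ a + (higher order terms)`, `c ≠ 0`. -/
noncomputable def leadingExponent (r : puiseuxSeries (AlgebraicClosure ℚ)) : ℚ :=
  (r : HahnSeries ℚ (AlgebraicClosure ℚ)).order

/-- The number of roots of `F`, counted with multiplicity, with leading exponent `a`. -/
noncomputable def numRoots (F : Polynomial (PowerSeries ℚ)) (a : ℚ) : ℕ :=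
  ((puiseuxRoots F).filter fun r => leadingExponent r = a).card

/-- The reduced support of `f`: the exponents `(j, k) ≠ (0, 0)` of the monomials `x₁ ^ j x₂ ^ k` that
occur in `f`. -/
def reducedSupport (f : MvPowerSeries (Fin 2) ℚ) : Set (Fin 2 →₀ ℕ) :=
  {d | d ≠ 0 ∧ MvPowerSeries.coeff d f ≠ 0}

/-- The Newton polyhedron of `f`: the convex hull of the union of the closed quadrants with corners in
the reduced support. -/
def newtonPolyhedron (f : MvPowerSeries (Fin 2) ℚ) : Set (ℝ × ℝ) :=
  convexHull ℝ (⋃ d ∈ reducedSupport f, {t | (d 0 : ℝ) ≤ t.1 ∧ (d 1 : ℝ) ≤ t.2})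

/-- The vertices of the Newton polygon of `f`: the extreme points of its Newton polyhedron. -/
def newtonVertices (f : MvPowerSeries (Fin 2) ℚ) : Set (ℝ × ℝ) :=
  (newtonPolyhedron f).extremePoints ℝ

/-! For a weight `w > 0`, consider the minimum of `j + w k` over the exponents `(j, k)` occurring in
a series. If each of two series attains its minimum at a single monomial, so does their product, at
the sum of the two exponents: this lowest product cannot cancel (`IsStrictMinimizer.add`).

By Newton–Puiseux, `F` is a product of factors `x₂ - r(x₁)`. When `w` is not a leading exponent, the
factor of a root of leading exponent `a` has its strict minimum at `(a, 0)` if `a < w` and at `(0,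
1)` if `w < a`. The unit `U` contributes `(0, 0)` and the monomial contributes `(ν₁, ν₂)`. For `w`
between `a_l` and `a_{l+1}` these add up to `(A_l, B_l)` (`isStrictMinimizer_vertex`), so each of
these points is the unique minimizer of a linear form with positive coefficients, hence a vertex.

There are no other vertices. Letting `w` tend to `a_{l+1}` gives a supporting line through `(A_l,
B_l)` and `(A_{l+1}, B_{l+1})`; the limits `w → 0` and `w → ∞` give the bounds `j ≥ A_0` and `k ≥
B_n`. A point satisfying all these inequalities lies in the hull of the quadrants at the `(A_l,
B_l)` (`mem_quadrantHull_of_le`), and every extreme point of such a hull is one of the corners. -/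

/-! ### The Newton–Puiseux theorem -/

open Polynomial in
-- A form of Hensel's lemma, by Weierstrass preparation: `P` is a distinguished polynomial `D` times
-- a unit power series, and `D` has degree the order of `P` modulo the maximal ideal, which is at
-- most `i`. The degree is positive because `P.coeff 0` is not a unit.
theorem exists_monic_mul_eq_of_residue {A : Type*} [CommRing A] [IsLocalRing A]
    [IsAdicComplete (IsLocalRing.maximalIdeal A) A] {P : A[X]} (hP : P.Monic)
    (h0 : P.coeff 0 ∈ IsLocalRing.maximalIdeal A) {i : ℕ} (hi : i < P.natDegree)
    (hi' : P.coeff i ∉ IsLocalRing.maximalIdeal A) :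
    ∃ D E : A[X], D.Monic ∧ E.Monic ∧ D * E = P ∧ D.natDegree < P.natDegree ∧
      E.natDegree < P.natDegree := by
  have hres : (PowerSeries.map (IsLocalRing.residue A) (P : PowerSeries A)).coeff i ≠ 0 := by
    simpa [IsLocalRing.residue_eq_zero_iff] using hi'
  have hne : PowerSeries.map (IsLocalRing.residue A) (P : PowerSeries A) ≠ 0 := by
    rintro h
    simp [h] at hres
  obtain ⟨D, h, H⟩ := PowerSeries.exists_isWeierstrassFactorization hne
  have hD : D.Monic := H.isDistinguishedAt.monic
  have hdeg := H.natDegree_eq_toNat_order_map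
  have hlt : D.natDegree < P.natDegree := by
    refine lt_of_le_of_lt ?_ hi
    rw [hdeg]
    exact ENat.toNat_le_of_le_natCast (PowerSeries.order_le i hres)
  have hpos : 0 < D.natDegree := by
    rw [Nat.pos_iff_ne_zero]
    intro h1
    rw [hD.natDegree_eq_zero] at h1
    have h2 := H.eq_mul
    rw [h1, Polynomial.coe_one, one_mul] at h2
    have h3 := PowerSeries.isUnit_iff_constantCoeff.1 H.isUnit
    rw [← h2] at h3
    simp only [Polynomial.constantCoeff_coe] at h3
    exact (IsLocalRing.mem_maximalIdeal _).1 h0 h3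
  have hord : ((D : PowerSeries A).map
      (Ideal.Quotient.mk (IsLocalRing.maximalIdeal A))).order.toNat = D.natDegree := by
    have := H.isDistinguishedAt.coe_natDegree_eq_order_map (D : PowerSeries A) 1
      (by simp [IsLocalRing.mem_maximalIdeal]) (by simp)
    rw [← this]; rfl
  -- Euclidean division by `D` is also a Weierstrass division, so by uniqueness its remainder is
  -- zero and the unit cofactor is the polynomial `P /ₘ D`.
  have hdiv := modByMonic_add_div P D
  have key := H.isDistinguishedAt.isWeierstrassDivisorAt'.eq_of_mul_add_eq_mul_add
    (q := h) (q' := ((P /ₘ D : A[X]) : PowerSeries A)) (r := 0) (r' := P %ₘ D)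
    (by rw [degree_zero]; exact WithBot.bot_lt_coe _)
    (by
      rw [hord]
      have := degree_modByMonic_lt P hD
      rwa [degree_eq_natDegree hD.ne_zero] at this)
    (by
      rw [← Polynomial.coe_mul, ← Polynomial.coe_add, add_comm _ (P %ₘ D), hdiv, H.eq_mul]
      simp)
  rw [← key.2, zero_add] at hdiv
  have hE : (P /ₘ D).Monic := hD.of_mul_monic_left (by rwa [hdiv])
  refine ⟨D, P /ₘ D, hD, hE, hdiv, hlt, ?_⟩
  have := hD.natDegree_mul hE
  rw [hdiv] at this
  omega

instance isAdicComplete_maximalIdeal_powerSeries (K : Type*) [Field K] :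
    IsAdicComplete (IsLocalRing.maximalIdeal (PowerSeries K)) (PowerSeries K) := by
  rw [PowerSeries.maximalIdeal_eq_span_X]
  infer_instance

open Polynomial in
/-- A monic polynomial over `K⟦X⟧` of degree `m` without term of degree `m - 1`, whose reduction is not
`X ^ m`, factors. -/
theorem exists_monic_mul_eq_of_constantCoeff {K : Type*} [Field K] [IsAlgClosed K] [CharZero K]
    {P : (PowerSeries K)[X]} (hP : P.Monic) (hpos : 0 < P.natDegree)
    (hsub : P.coeff (P.natDegree - 1) = 0) {i : ℕ} (hi : i < P.natDegree)
    (hi' : PowerSeries.constantCoeff (P.coeff i) ≠ 0) :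
    ∃ D E : (PowerSeries K)[X], D.Monic ∧ E.Monic ∧ D * E = P ∧ D.natDegree < P.natDegree ∧
      E.natDegree < P.natDegree := by
  set p : K[X] := P.map PowerSeries.constantCoeff with hp
  have hpm : p.Monic := hP.map _
  have hpd : p.natDegree = P.natDegree := hP.natDegree_map _
  have hmem (g : PowerSeries K) : g ∈ IsLocalRing.maximalIdeal (PowerSeries K) ↔
      PowerSeries.constantCoeff g = 0 := by
    rw [← PowerSeries.ker_coeff_eq_max_ideal, RingHom.mem_ker]
  obtain ⟨α, hα⟩ := IsAlgClosed.exists_root p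
    (by rw [degree_eq_natDegree hpm.ne_zero, hpd]; exact_mod_cast hpos.ne')
  have hmap : (taylor (PowerSeries.C α) P).map PowerSeries.constantCoeff = taylor α p := by
    rw [map_taylor]; simp [hp]
  have hc (j : ℕ) : PowerSeries.constantCoeff ((taylor (PowerSeries.C α) P).coeff j) =
      (taylor α p).coeff j := by rw [← hmap, coeff_map]
  have hTm : (taylor (PowerSeries.C α) P).Monic := by
    rw [Monic, leadingCoeff_taylor]; exact hP
  -- Otherwise `p = (X - α) ^ m`. The vanishing coefficient of degree `m - 1` gives `m α = 0`, so `α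
  -- = 0` in characteristic zero and `p = X ^ m`, contrary to `hi'`.
  have hex : ∃ j < P.natDegree, (taylor α p).coeff j ≠ 0 := by
    by_contra! hcon
    have hX : taylor α p = X ^ P.natDegree := by
      ext j
      rcases lt_trichotomy j P.natDegree with h | h | h
      · rw [hcon j h, coeff_X_pow, if_neg h.ne]
      · rw [h, coeff_X_pow, if_pos rfl, ← hpd, coeff_taylor_natDegree]; exact hpm
      · rw [coeff_X_pow, if_neg h.ne', coeff_eq_zero_of_natDegree_lt]
        rwa [natDegree_taylor, hpd]
    have hp' : p = (X + C (-α)) ^ P.natDegree := by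
      have := congrArg (taylor (-α)) hX
      rwa [taylor_taylor, neg_add_cancel, taylor_zero, taylor_X_pow] at this
    have hα0 : α = 0 := by
      have h1 : p.coeff (P.natDegree - 1) = 0 := by rw [hp, coeff_map, hsub, map_zero]
      rw [hp', coeff_X_add_C_pow, Nat.sub_sub_self hpos, pow_one, Nat.choose_symm hpos,
        Nat.choose_one_right] at h1
      simpa [hpos.ne'] using h1
    rw [hα0, neg_zero, C_0, add_zero] at hp'
    apply hi'
    rw [← coeff_map, ← hp, hp', coeff_X_pow, if_neg hi.ne]
  obtain ⟨j, hj, hj'⟩ := hex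
  obtain ⟨D, E, hD, hE, hDE, h1, h2⟩ := exists_monic_mul_eq_of_residue hTm (i := j)
    (by rw [hmem, hc, taylor_coeff_zero]; exact hα) (by rwa [natDegree_taylor])
    (by rwa [hmem, hc])
  rw [natDegree_taylor] at h1 h2
  refine ⟨taylor (PowerSeries.C (-α)) D, taylor (PowerSeries.C (-α)) E, ?_, ?_, ?_, ?_, ?_⟩
  · rwa [Monic, leadingCoeff_taylor]
  · rwa [Monic, leadingCoeff_taylor]
  · rw [← taylor_mul, hDE, taylor_taylor, ← map_add, neg_add_cancel, map_zero, taylor_zero]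
  · rwa [natDegree_taylor]
  · rwa [natDegree_taylor]

/-- The substitution `x ↦ x ^ q` of power series, as a ring homomorphism. -/
noncomputable abbrev PowerSeries.expandRingHom (K : Type*) [Field K] (q : ℕ) (hq : q ≠ 0) :
    PowerSeries K →+* PowerSeries K :=
  (PowerSeries.expand q hq : PowerSeries K →ₐ[K] PowerSeries K)

open Polynomial in
/-- The polynomial `P(x, y)` splits into linear factors over the power series in `x ^ (1 / q)` for
some `q`, i.e. `P(x ^ q, y)` splits over the power series in `x`. -/
def SplitsAfterRamification {K : Type*} [Field K] (P : (PowerSeries K)[X]) : Prop :=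
  ∃ q : ℕ, ∃ hq : q ≠ 0, (P.map (PowerSeries.expandRingHom K q hq)).Splits

namespace SplitsAfterRamification

open Polynomial

variable {K : Type*} [Field K] {P Q : (PowerSeries K)[X]}

theorem of_map_expand {q : ℕ} (hq : q ≠ 0)
    (h : SplitsAfterRamification
      (P.map (PowerSeries.expandRingHom K q hq))) :
    SplitsAfterRamification P := by
  obtain ⟨r, hr, h⟩ := h
  refine ⟨r * q, Nat.mul_ne_zero hr hq, ?_⟩
  convert h using 1
  rw [Polynomial.map_map]
  congr 1
  ext1 g
  simpa using PowerSeries.expand_mul r hr q hq g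

theorem splits_of_dvd {q r : ℕ} (hq : q ≠ 0) (hr : r ≠ 0) (hqr : q ∣ r)
    (h : (P.map (PowerSeries.expandRingHom K q hq)).Splits) :
    (P.map (PowerSeries.expandRingHom K r hr)).Splits := by
  obtain ⟨s, rfl⟩ := hqr
  have hs : s ≠ 0 := right_ne_zero_of_mul hr
  have h1 := h.map (PowerSeries.expandRingHom K s hs)
  convert h1 using 1
  rw [Polynomial.map_map]
  congr 1
  ext1 g
  have := PowerSeries.expand_mul s hs q hq g
  simp only [mul_comm s q] at this
  simpa using this

theorem mul (hP : SplitsAfterRamification P) (hQ : SplitsAfterRamification Q) :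
    SplitsAfterRamification (P * Q) := by
  obtain ⟨q, hq, hP⟩ := hP
  obtain ⟨r, hr, hQ⟩ := hQ
  refine ⟨q * r, Nat.mul_ne_zero hq hr, ?_⟩
  rw [Polynomial.map_mul]
  exact (splits_of_dvd hq _ (dvd_mul_right _ _) hP).mul (splits_of_dvd hr _ (dvd_mul_left _ _) hQ)

theorem of_taylor {g : PowerSeries K} (h : SplitsAfterRamification (taylor g P)) :
    SplitsAfterRamification P := by
  obtain ⟨q, hq, h⟩ := h
  refine ⟨q, hq, ?_⟩
  rw [map_taylor] at h
  have := h.taylor (-(PowerSeries.expandRingHom K q hq) g)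
  rwa [taylor_taylor, neg_add_cancel, taylor_zero] at this

theorem scaleRoots (hm : P.Monic) (h : SplitsAfterRamification P) (g : PowerSeries K) :
    SplitsAfterRamification (P.scaleRoots g) := by
  obtain ⟨q, hq, h⟩ := h
  refine ⟨q, hq, ?_⟩
  rw [map_scaleRoots _ _ _ (by rw [hm.leadingCoeff, map_one]; exact one_ne_zero)]
  exact h.scaleRoots _

end SplitsAfterRamification

open Polynomial in
/-- After a substitution `x ↦ x ^ q`, `y ↦ x ^ p y` the Newton polygon of `P` has a horizontal
edge. -/
theorem exists_map_expand_eq_scaleRoots {K : Type*} [Field K] {P : (PowerSeries K)[X]}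
    (hP : P.Monic) (hX : P ≠ X ^ P.natDegree) :
    ∃ (q : ℕ) (hq : q ≠ 0) (p : ℕ) (Q : (PowerSeries K)[X]), Q.Monic ∧ Q.natDegree = P.natDegree ∧
      P.map (PowerSeries.expandRingHom K q hq) =
        Q.scaleRoots (PowerSeries.X ^ p) ∧
      ∃ i < P.natDegree, PowerSeries.constantCoeff (Q.coeff i) ≠ 0 := by
  classical
  set m := P.natDegree with hm
  have hS : ((Finset.range m).filter fun i => P.coeff i ≠ 0).Nonempty := by
    by_contra hcon
    rw [Finset.not_nonempty_iff_eq_empty, Finset.filter_eq_empty_iff] at hcon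
    refine hX (Polynomial.ext fun i => ?_)
    rcases lt_trichotomy i m with h | h | h
    · have := hcon (Finset.mem_range.2 h)
      rw [coeff_X_pow, if_neg h.ne]
      simpa using this
    · rw [h, coeff_X_pow, if_pos rfl]; exact hP
    · rw [coeff_X_pow, if_neg h.ne', coeff_eq_zero_of_natDegree_lt h]
  -- The minimal ratio `p / q` is the slope of an edge of the Newton polygon ending at `(m, 0)`.
  -- Minimality says exactly that, after `x ↦ x ^ q`, the coefficient of degree `i` is divisible by
  -- `x ^ (p (m - i))`.
  obtain ⟨k, hk, hmin⟩ := Finset.exists_min_image _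
    (fun i => ((P.coeff i).order.toNat : ℚ) / ((m - i : ℕ) : ℚ)) hS
  simp only [Finset.mem_filter, Finset.mem_range] at hk hmin
  set q := m - k with hqdef
  set p := (P.coeff k).order.toNat with hpdef
  have hq : q ≠ 0 := by omega
  let φ := PowerSeries.expandRingHom K q hq
  have hφX : φ PowerSeries.X = PowerSeries.X ^ q := PowerSeries.expand_X q hq
  have hdvd (i : ℕ) : ∃ d, φ (P.coeff i) = PowerSeries.X ^ (p * (m - i)) * d := by
    by_cases hi : P.coeff i = 0
    · exact ⟨0, by rw [hi]; simp⟩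
    rcases lt_or_ge i m with him | him
    · have h1 := hmin i ⟨him, hi⟩
      rw [div_le_div_iff₀ (by exact_mod_cast Nat.pos_of_ne_zero hq)
        (by exact_mod_cast Nat.sub_pos_of_lt him)] at h1
      have h2 : p * (m - i) ≤ q * (P.coeff i).order.toNat := by
        rw [mul_comm q]; exact_mod_cast h1
      have h3 : PowerSeries.X ^ (P.coeff i).order.toNat ∣ P.coeff i := PowerSeries.X_pow_order_dvd
      have h4 := map_dvd φ h3
      rw [map_pow, hφX, ← pow_mul] at h4
      exact (pow_dvd_pow _ h2).trans h4
    · rw [Nat.sub_eq_zero_of_le him]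
      exact ⟨φ (P.coeff i), by rw [mul_zero, pow_zero, one_mul]⟩
  choose d hd using hdvd
  have hdm : d m = 1 := by
    have := hd m
    rw [Nat.sub_self, mul_zero, pow_zero, one_mul, hm, hP.coeff_natDegree, map_one] at this
    exact this.symm
  let Q : (PowerSeries K)[X] := ∑ i ∈ Finset.range (m + 1), monomial i (d i)
  have hQc (i : ℕ) : Q.coeff i = if i < m + 1 then d i else 0 := by
    simp [Q, finsetSum_coeff, coeff_monomial]
  have hQle : Q.natDegree ≤ m := natDegree_le_iff_coeff_eq_zero.2 fun N hN => by
    rw [hQc, if_neg (by omega)]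
  have hQm : Q.coeff m = 1 := by rw [hQc, if_pos (by omega), hdm]
  have hQmonic : Q.Monic := monic_of_natDegree_le_of_coeff_eq_one m hQle hQm
  have hQdeg : Q.natDegree = m :=
    natDegree_eq_of_le_of_coeff_ne_zero hQle (by rw [hQm]; exact one_ne_zero)
  refine ⟨q, hq, p, Q, hQmonic, hQdeg, ?_, k, hk.1, ?_⟩
  · ext1 i
    rw [coeff_map, coeff_scaleRoots, hQdeg, hQc]
    change φ (P.coeff i) = _
    split_ifs with h
    · rw [hd i, ← pow_mul, mul_comm]
    · rw [coeff_eq_zero_of_natDegree_lt (by omega)]; simp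
  · rw [hQc, if_pos (by omega)]
    obtain ⟨u, hu⟩ : PowerSeries.X ^ p ∣ P.coeff k := PowerSeries.X_pow_order_dvd
    have h1 := hd k
    have h2 := congrArg φ hu
    rw [map_mul, map_pow, hφX, ← pow_mul, mul_comm q p, h1] at h2
    have h3 : d k = φ u := mul_left_cancel₀ (pow_ne_zero _ PowerSeries.X_ne_zero) h2
    rw [h3]
    change PowerSeries.constantCoeff (PowerSeries.expand q hq u) ≠ 0
    rw [PowerSeries.constantCoeff_expand]
    -- If `u` had zero constant term, `x ^ (p + 1)` would divide `P.coeff k`, whose order is `p`.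
    intro h0
    obtain ⟨v, hv⟩ := PowerSeries.X_dvd_iff.2 h0
    have h5 : PowerSeries.X ^ (p + 1) ∣ P.coeff k := ⟨v, by rw [hu, hv]; ring⟩
    have h6 := PowerSeries.X_pow_dvd_iff.1 h5 p (Nat.lt_succ_self _)
    exact PowerSeries.coeff_order hk.2 h6

open Polynomial in
/-- **Newton–Puiseux theorem**. -/
theorem splitsAfterRamification_of_monic {K : Type*} [Field K] [IsAlgClosed K] [CharZero K]
    (P : (PowerSeries K)[X]) (hP : P.Monic) : SplitsAfterRamification P := by
  induction hn : P.natDegree using Nat.strong_induction_on generalizing P with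
  | _ m ih =>
  have hX (n : ℕ) : SplitsAfterRamification (X ^ n : (PowerSeries K)[X]) :=
    ⟨1, one_ne_zero, by rw [Polynomial.map_pow, map_X]; exact Splits.X_pow n⟩
  rcases Nat.eq_zero_or_pos m with rfl | hm
  · rw [hP.natDegree_eq_zero.1 hn]; exact hX 0
  -- Tschirnhaus shift: translating by the mean of the roots removes the term of degree `m - 1`.
  set g : PowerSeries K := -((m : PowerSeries K)⁻¹ * P.coeff (m - 1)) with hg
  have hmK : (m : PowerSeries K) * (m : PowerSeries K)⁻¹ = 1 := by
    refine PowerSeries.mul_inv_cancel _ ?_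
    rw [map_natCast]; exact_mod_cast hm.ne'
  apply SplitsAfterRamification.of_taylor (g := g)
  have hTm : (taylor g P).Monic := by rwa [Monic, leadingCoeff_taylor]
  have hTd : (taylor g P).natDegree = m := by rw [natDegree_taylor, hn]
  have hT0 : (taylor g P).coeff (m - 1) = 0 := by
    have h1 : (hasseDeriv (m - 1) P) = C (P.coeff (m - 1)) + C (m : PowerSeries K) * X := by
      ext1 i
      rw [hasseDeriv_coeff, coeff_add, coeff_C, coeff_C_mul, coeff_X]
      rcases i with _ | _ | i
      · simp
      · have h2 : P.coeff m = 1 := by rw [← hn]; exact hP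
        have h3 : 0 + 1 + (m - 1) = m := by omega
        rw [h3, h2, ← Nat.choose_symm (Nat.sub_le m 1), Nat.sub_sub_self hm, Nat.choose_one_right]
        simp
      · rw [coeff_eq_zero_of_natDegree_lt (by omega)]; simp
    rw [taylor_coeff, h1]
    simp only [eval_add, eval_C, eval_mul, eval_X, hg]
    rw [mul_neg, ← mul_assoc, hmK, one_mul, add_neg_cancel]
  generalize taylor g P = T at *
  by_cases hTX : T = X ^ T.natDegree
  · rw [hTX]; exact hX _
  obtain ⟨q, hq, p, Q, hQ, hQd, hQT, i, hi, hi'⟩ := exists_map_expand_eq_scaleRoots hTm hTX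
  apply SplitsAfterRamification.of_map_expand hq
  rw [hQT]
  apply SplitsAfterRamification.scaleRoots hQ
  -- Scaling roots multiplies coefficients by powers of `x`, which are nonzero, so the missing term
  -- stays missing.
  have hQ0 : Q.coeff (Q.natDegree - 1) = 0 := by
    have h1 := congrArg (fun R => R.coeff (m - 1)) hQT
    simp only [coeff_map, hT0, map_zero, coeff_scaleRoots] at h1
    rw [hQd, hTd]
    exact (mul_eq_zero.1 h1.symm).resolve_right
      (pow_ne_zero _ (pow_ne_zero _ PowerSeries.X_ne_zero))
  obtain ⟨D, E, hD, hE, hDE, h1, h2⟩ := exists_monic_mul_eq_of_constantCoeff hQ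
    (by omega) hQ0 (hQd ▸ hi) hi'
  rw [← hDE]
  rw [hQd, hTd] at h1 h2
  exact (ih _ h1 D hD rfl).mul (ih _ h2 E hE rfl)

/-! ### Splitting over the Puiseux series -/

/-- The embedding of power series into Puiseux series sending the variable to `x ^ (1 / q)`. -/
noncomputable def HahnSeries.ofPowerSeriesRoot (K : Type*) [Field K] (q : ℕ) (hq : q ≠ 0) :
    PowerSeries K →+* HahnSeries ℚ K :=
  (HahnSeries.embDomainRingHom
    ((AddMonoidHom.mulRight (q : ℚ)⁻¹).comp (Nat.castAddMonoidHom ℚ))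
    (fun a b h => by
      have : (q : ℚ)⁻¹ ≠ 0 := inv_ne_zero (by exact_mod_cast hq)
      simpa [this] using h)
    (fun a b => by
      have : 0 < (q : ℚ)⁻¹ := inv_pos.2 (by exact_mod_cast Nat.pos_of_ne_zero hq)
      simp [this])).comp
    HahnSeries.toPowerSeries.symm.toRingHom

theorem HahnSeries.coeff_ofPowerSeriesRoot {K : Type*} [Field K] {q : ℕ} (hq : q ≠ 0)
    (g : PowerSeries K) (n : ℕ) :
    (HahnSeries.ofPowerSeriesRoot K q hq g).coeff (n * (q : ℚ)⁻¹) = PowerSeries.coeff n g := by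
  change (HahnSeries.embDomain _ _).coeff _ = _
  exact (HahnSeries.embDomain_coeff (a := n)).trans (by simp)

theorem HahnSeries.coeff_ofPowerSeriesRoot_of_ne {K : Type*} [Field K] {q : ℕ} (hq : q ≠ 0)
    (g : PowerSeries K) {a : ℚ} (ha : ∀ n : ℕ, a ≠ n * (q : ℚ)⁻¹) :
    (HahnSeries.ofPowerSeriesRoot K q hq g).coeff a = 0 := by
  change (HahnSeries.embDomain _ _).coeff _ = _
  refine HahnSeries.embDomain_of_notMem_range ?_
  rintro ⟨n, rfl⟩
  exact ha n rfl

theorem HahnSeries.coeff_ofPowerSeries_of_ne {K : Type*} [Field K]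
    (g : PowerSeries K) {a : ℚ} (ha : ∀ n : ℕ, a ≠ n) :
    (HahnSeries.ofPowerSeries ℚ K g).coeff a = 0 := by
  rw [HahnSeries.ofPowerSeries_apply]
  refine HahnSeries.embDomain_of_notMem_range ?_
  rintro ⟨n, rfl⟩
  exact ha n rfl

theorem HahnSeries.ofPowerSeriesRoot_mem_puiseuxSeries {K : Type*} [Field K] {q : ℕ} (hq : q ≠ 0)
    (g : PowerSeries K) : HahnSeries.ofPowerSeriesRoot K q hq g ∈ puiseuxSeries K := by
  refine ⟨q, Nat.pos_of_ne_zero hq, fun a ha => ?_⟩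
  by_contra h
  refine ha (HahnSeries.coeff_ofPowerSeriesRoot_of_ne hq g fun n hn => h ⟨n, ?_⟩)
  rw [hn, inv_mul_cancel_right₀ (by exact_mod_cast hq), Int.cast_natCast]

/-- Substituting `x ^ (1 / q)` undoes the ramification `x ↦ x ^ q`; this carries the splitting after
ramification back to the original polynomial. -/
theorem HahnSeries.ofPowerSeriesRoot_expand {K : Type*} [Field K] {q : ℕ} (hq : q ≠ 0)
    (g : PowerSeries K) :
    HahnSeries.ofPowerSeriesRoot K q hq (PowerSeries.expand q hq g) =
      HahnSeries.ofPowerSeries ℚ K g := by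
  have hq' : (q : ℚ) ≠ 0 := by exact_mod_cast hq
  ext a
  by_cases ha : ∃ n : ℕ, a = n * (q : ℚ)⁻¹
  · obtain ⟨n, rfl⟩ := ha
    rw [HahnSeries.coeff_ofPowerSeriesRoot, PowerSeries.coeff_expand]
    split_ifs with h
    · obtain ⟨k, rfl⟩ := h
      rw [Nat.mul_div_cancel_left _ (Nat.pos_of_ne_zero hq), Nat.cast_mul, mul_comm (q : ℚ),
        mul_inv_cancel_right₀ hq', HahnSeries.ofPowerSeries_apply_coeff]
    · rw [HahnSeries.coeff_ofPowerSeries_of_ne]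
      intro k hk
      rw [← div_eq_mul_inv, div_eq_iff hq'] at hk
      exact h ⟨k, by rw [mul_comm]; exact_mod_cast hk⟩
  · push Not at ha
    rw [HahnSeries.coeff_ofPowerSeriesRoot_of_ne hq _ ha, HahnSeries.coeff_ofPowerSeries_of_ne]
    intro n hn
    refine ha (n * q) ?_
    rw [hn, Nat.cast_mul, mul_inv_cancel_right₀ hq']

open Polynomial in
theorem splits_map_puiseuxSeries {K : Type*} [Field K] [IsAlgClosed K] [CharZero K]
    {P : (PowerSeries K)[X]} (hP : P.Monic) :
    (P.map ((HahnSeries.ofPowerSeries ℚ K).codRestrict (puiseuxSeries K)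
      (ofPowerSeries_mem_puiseuxSeries K))).Splits := by
  obtain ⟨q, hq, h⟩ := splitsAfterRamification_of_monic P hP
  have h1 := h.map ((HahnSeries.ofPowerSeriesRoot K q hq).codRestrict (puiseuxSeries K)
    (HahnSeries.ofPowerSeriesRoot_mem_puiseuxSeries hq))
  rw [Polynomial.map_map] at h1
  convert h1 using 2
  ext1 g
  exact Subtype.ext (HahnSeries.ofPowerSeriesRoot_expand hq g).symm

open Polynomial in
theorem splits_map_toPuiseux {F : (PowerSeries ℚ)[X]} (hF : F.Monic) :
    (F.map toPuiseux).Splits := by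
  rw [toPuiseux, ← Polynomial.map_map]
  exact splits_map_puiseuxSeries (hF.map _)

/-! ### Strict minimizers and their additivity under products -/

/-- `p` is the only point of `S` where `(j, k) ↦ j + w k` attains its minimum on `S`. -/
def IsStrictMinimizer (w : ℚ) (S : Set (ℚ × ℕ)) (p : ℚ × ℕ) : Prop :=
  p ∈ S ∧ ∀ s ∈ S, s ≠ p → p.1 + w * p.2 < s.1 + w * s.2

/-- The weight is additive, so `p + q` is the sum of least weight and decomposes in only one way.
Here `R` stands for the support of a product: it lies in `S + T`, and a sum with a unique
decomposition cannot cancel. The abstract form serves both kinds of series below. -/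
theorem IsStrictMinimizer.add {w : ℚ} {S T R : Set (ℚ × ℕ)} {p q : ℚ × ℕ}
    (hp : IsStrictMinimizer w S p) (hq : IsStrictMinimizer w T q)
    (hR : ∀ r ∈ R, ∃ s ∈ S, ∃ t ∈ T, s + t = r)
    (hR' : ∀ s ∈ S, ∀ t ∈ T, (∀ s' ∈ S, ∀ t' ∈ T, s' + t' = s + t → s' = s ∧ t' = t) → s + t ∈ R) :
    IsStrictMinimizer w R (p + q) := by
  have key : ∀ s ∈ S, ∀ t ∈ T, (s ≠ p ∨ t ≠ q) →
      (p + q).1 + w * (p + q).2 < (s + t).1 + w * (s + t).2 := by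
    intro s hs t ht h
    have h1 : p.1 + w * p.2 ≤ s.1 + w * s.2 := by
      by_cases h : s = p
      · rw [h]
      · exact (hp.2 s hs h).le
    have h2 : q.1 + w * q.2 ≤ t.1 + w * t.2 := by
      by_cases h : t = q
      · rw [h]
      · exact (hq.2 t ht h).le
    simp only [Prod.fst_add, Prod.snd_add, Nat.cast_add]
    rcases h with h | h
    · linarith [hp.2 s hs h]
    · linarith [hq.2 t ht h]
  refine ⟨hR' p hp.1 q hq.1 fun s hs t ht h => ?_, fun r hr hne => ?_⟩
  · by_contra hcon
    have := key s hs t ht (by tauto)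
    rw [h] at this
    exact lt_irrefl _ this
  · obtain ⟨s, hs, t, ht, rfl⟩ := hR r hr
    refine key s hs t ht ?_
    by_contra! hcon
    exact hne (by rw [hcon.1, hcon.2])

/-- The exponents of the monomials of a polynomial with Hahn series coefficients. -/
def Polynomial.hahnSupport {K : Type*} [Field K] (P : Polynomial (HahnSeries ℚ K)) : Set (ℚ × ℕ) :=
  {p | (P.coeff p.2).coeff p.1 ≠ 0}

/-- The exponents of the monomials of a power series in two variables. -/
def MvPowerSeries.planeSupport {K : Type*} [Field K] (f : MvPowerSeries (Fin 2) K) :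
    Set (ℚ × ℕ) :=
  (fun d : Fin 2 →₀ ℕ => ((d 0 : ℚ), d 1)) '' {d | MvPowerSeries.coeff d f ≠ 0}

section Multiplicativity

variable {K : Type*} [Field K] {w : ℚ} {p q : ℚ × ℕ}

theorem HahnSeries.exists_of_coeff_mul_ne_zero {x y : HahnSeries ℚ K} {a : ℚ}
    (h : (x * y).coeff a ≠ 0) : ∃ i j, x.coeff i ≠ 0 ∧ y.coeff j ≠ 0 ∧ i + j = a := by
  rw [HahnSeries.coeff_mul] at h
  obtain ⟨ij, hij, _⟩ := Finset.exists_ne_zero_of_sum_ne_zero h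
  rw [Finset.mem_antidiagonal] at hij
  exact ⟨ij.1, ij.2, hij.1, hij.2.1, hij.2.2⟩

theorem IsStrictMinimizer.polynomial_mul {P Q : Polynomial (HahnSeries ℚ K)}
    (hP : IsStrictMinimizer w P.hahnSupport p) (hQ : IsStrictMinimizer w Q.hahnSupport q) :
    IsStrictMinimizer w (P * Q).hahnSupport (p + q) := by
  refine hP.add hQ ?_ ?_
  · rintro ⟨j, k⟩ h
    change ((P * Q).coeff k).coeff j ≠ 0 at h
    rw [Polynomial.coeff_mul, HahnSeries.coeff_sum] at h
    obtain ⟨ab, hab, h⟩ := Finset.exists_ne_zero_of_sum_ne_zero h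
    obtain ⟨i, i', hi, hi', hii⟩ := HahnSeries.exists_of_coeff_mul_ne_zero h
    rw [Finset.HasAntidiagonal.mem_antidiagonal] at hab
    exact ⟨(i, ab.1), hi, (i', ab.2), hi', Prod.ext hii hab⟩
  · rintro ⟨j, k⟩ hs ⟨j', k'⟩ ht h
    change ((P * Q).coeff (k + k')).coeff (j + j') ≠ 0
    rw [Polynomial.coeff_mul, HahnSeries.coeff_sum, Finset.sum_eq_single (k, k'),
      HahnSeries.coeff_mul, Finset.sum_eq_single (j, j')]
    · exact mul_ne_zero hs ht
    · rintro ⟨i, i'⟩ hi hne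
      rw [Finset.mem_antidiagonal] at hi
      have := h (i, k) hi.1 (i', k') hi.2.1 (Prod.ext hi.2.2 rfl)
      simp only [Prod.mk.injEq] at this
      exact absurd (by rw [this.1.1, this.2.1]) hne
    · intro hn
      exact absurd (Finset.mem_antidiagonal.2 ⟨hs, ht, rfl⟩) hn
    · rintro ⟨a, b⟩ hab hne
      rw [Finset.HasAntidiagonal.mem_antidiagonal] at hab
      by_contra hcon
      obtain ⟨i, i', hi, hi', hii⟩ := HahnSeries.exists_of_coeff_mul_ne_zero hcon
      have := h (i, a) hi (i', b) hi' (Prod.ext hii hab)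
      simp only [Prod.mk.injEq] at this
      exact hne (by rw [this.1.2, this.2.2])
    · intro hn
      exact (hn (by simp)).elim

theorem IsStrictMinimizer.mvPowerSeries_mul {f g : MvPowerSeries (Fin 2) K}
    (hf : IsStrictMinimizer w f.planeSupport p) (hg : IsStrictMinimizer w g.planeSupport q) :
    IsStrictMinimizer w (f * g).planeSupport (p + q) := by
  classical
  refine hf.add hg ?_ ?_
  · rintro _ ⟨d, h, rfl⟩
    rw [Set.mem_ofPred_eq, MvPowerSeries.coeff_mul] at h
    obtain ⟨ab, hab, h⟩ := Finset.exists_ne_zero_of_sum_ne_zero h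
    rw [Finset.HasAntidiagonal.mem_antidiagonal] at hab
    refine ⟨_, ⟨ab.1, left_ne_zero_of_mul h, rfl⟩, _, ⟨ab.2, right_ne_zero_of_mul h, rfl⟩, ?_⟩
    rw [← hab]
    ext <;> simp
  · rintro _ ⟨d, hd, rfl⟩ _ ⟨e, he, rfl⟩ h
    refine ⟨d + e, ?_, by ext <;> simp⟩
    rw [Set.mem_ofPred_eq, MvPowerSeries.coeff_mul, Finset.sum_eq_single (d, e)]
    · exact mul_ne_zero hd he
    · rintro ⟨a, b⟩ hab hne
      rw [Finset.HasAntidiagonal.mem_antidiagonal] at hab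
      by_contra hcon
      have hinj (u v : Fin 2 →₀ ℕ) (huv : ((u 0 : ℚ), u 1) = ((v 0 : ℚ), v 1)) : u = v := by
        rw [Prod.mk.injEq, Nat.cast_inj] at huv
        ext i
        fin_cases i
        · exact huv.1
        · exact huv.2
      have := h _ ⟨a, left_ne_zero_of_mul hcon, rfl⟩ _ ⟨b, right_ne_zero_of_mul hcon, rfl⟩ (by
        have h0 := DFunLike.congr_fun hab 0
        have h1 := DFunLike.congr_fun hab 1
        simp only [Finsupp.add_apply] at h0 h1
        ext
        · simp only [Prod.fst_add]; exact_mod_cast h0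
        · exact h1)
      exact hne (Prod.ext (hinj _ _ this.1) (hinj _ _ this.2))
    · intro hn
      exact (hn (by simp)).elim

end Multiplicativity

/-! ### Strict minimizers of the individual factors -/

section Factors

variable {K : Type*} [Field K] {w : ℚ}

-- The monomial `(0, 1)` has weight `w` and the others `(j, 0)` have `j ≥ r.order`, with equality
-- attained; since `r.order ≠ w`, the smaller of the two weights wins strictly.
open Polynomial in
theorem isStrictMinimizer_X_sub_C {r : HahnSeries ℚ K} (hr : r ≠ 0) (hw : r.order ≠ w) :
    IsStrictMinimizer w (X - C r).hahnSupport
      (if r.order < w then r.order else 0, if w < r.order then 1 else 0) := by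
  have hS (p : ℚ × ℕ) (hp : p ∈ (X - C r).hahnSupport) :
      p = (0, 1) ∨ (p.2 = 0 ∧ r.order ≤ p.1) := by
    obtain ⟨j, k⟩ := p
    change ((X - C r).coeff k).coeff j ≠ 0 at hp
    rcases k with _ | _ | k
    · simp only [coeff_sub, coeff_X_zero, coeff_C_zero, zero_sub, HahnSeries.coeff_neg,
        ne_eq, neg_eq_zero] at hp
      exact Or.inr ⟨rfl, HahnSeries.order_le_of_coeff_ne_zero hp⟩
    · simp [coeff_X, HahnSeries.coeff_one] at hp
      simp [hp]
    · simp [coeff_X] at hp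
  rcases lt_or_gt_of_ne hw with h | h
  · rw [if_pos h, if_neg h.not_gt]
    refine ⟨?_, fun p hp hne => ?_⟩
    · simpa [hahnSupport, HahnSeries.coeff_order_eq_zero] using hr
    · rcases hS p hp with rfl | ⟨h1, h2⟩
      · simpa using h
      · have h3 : r.order ≠ p.1 := fun h => hne (Prod.ext h.symm h1)
        simpa [h1] using lt_of_le_of_ne h2 h3
  · rw [if_neg h.not_gt, if_pos h]
    refine ⟨?_, fun p hp hne => ?_⟩
    · simp [hahnSupport, HahnSeries.coeff_one, coeff_X, coeff_C]
    · rcases hS p hp with rfl | ⟨h1, h2⟩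
      · exact absurd rfl hne
      · simpa [h1] using lt_of_lt_of_le h h2

open Polynomial in
theorem isStrictMinimizer_prod_X_sub_C {s : Multiset (HahnSeries ℚ K)}
    (hs : ∀ r ∈ s, r ≠ 0 ∧ r.order ≠ w) :
    IsStrictMinimizer w (s.map fun r => X - C r).prod.hahnSupport
      ((s.map fun r => if r.order < w then r.order else 0).sum,
        (s.map fun r => if w < r.order then 1 else 0).sum) := by
  induction s using Multiset.induction_on with
  | empty =>
    refine ⟨by simp [hahnSupport], ?_⟩
    rintro ⟨j, k⟩ hp hne
    simp only [Multiset.map_zero, Multiset.prod_zero, hahnSupport, Set.mem_ofPred_eq,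
      coeff_one] at hp
    split_ifs at hp with hk
    · have hj : j = 0 := by simpa [HahnSeries.coeff_one] using hp
      exact absurd (by simp [hj, hk]) hne
    · simp at hp
  | cons r s ih =>
    have h1 := hs r (Multiset.mem_cons_self r s)
    simp only [Multiset.map_cons, Multiset.prod_cons, Multiset.sum_cons]
    exact (isStrictMinimizer_X_sub_C h1.1 h1.2).polynomial_mul
      (ih fun t ht => hs t (Multiset.mem_cons_of_mem ht))

theorem isStrictMinimizer_of_constantCoeff_ne_zero (hw : 0 < w) {U : MvPowerSeries (Fin 2) K}
    (hU : MvPowerSeries.constantCoeff U ≠ 0) : IsStrictMinimizer w U.planeSupport (0, 0) := by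
  refine ⟨⟨0, by simpa using hU, by simp⟩, ?_⟩
  rintro _ ⟨d, _, rfl⟩ hne
  have h : d 0 ≠ 0 ∨ d 1 ≠ 0 := by
    by_contra! hcon
    exact hne (by simp [hcon])
  have h0 : (0 : ℚ) ≤ d 0 := by positivity
  have h1 : (0 : ℚ) ≤ w * d 1 := by positivity
  simp only [Nat.cast_zero, mul_zero, add_zero]
  rcases h with h | h
  · have : (0 : ℚ) < d 0 := by exact_mod_cast Nat.pos_of_ne_zero h
    linarith
  · have : (0 : ℚ) < w * d 1 := mul_pos hw (by exact_mod_cast Nat.pos_of_ne_zero h)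
    linarith

theorem isStrictMinimizer_X_pow (i : Fin 2) (n : ℕ) :
    IsStrictMinimizer w (MvPowerSeries.X i ^ n : MvPowerSeries (Fin 2) K).planeSupport
      ((Finsupp.single i n 0 : ℕ), Finsupp.single i n 1) := by
  classical
  refine ⟨⟨Finsupp.single i n, by simp [MvPowerSeries.coeff_X_pow], rfl⟩, ?_⟩
  rintro _ ⟨d, hd, rfl⟩ hne
  simp only [Set.mem_ofPred_eq, MvPowerSeries.coeff_X_pow, ne_eq, ite_eq_right_iff, one_ne_zero,
    imp_false, not_not] at hd
  exact absurd (by rw [hd]) hne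

end Factors

/-! ### The support of `F` and the leading exponents of its roots -/

theorem HahnSeries.coeff_subtype_toPuiseux (g : PowerSeries ℚ) (n : ℕ) :
    ((puiseuxSeries (AlgebraicClosure ℚ)).subtype (toPuiseux g)).coeff (n : ℚ) =
      algebraMap ℚ (AlgebraicClosure ℚ) (PowerSeries.coeff n g) := by
  change (HahnSeries.ofPowerSeries ℚ (AlgebraicClosure ℚ) (PowerSeries.map _ g)).coeff (n : ℚ) = _
  rw [HahnSeries.ofPowerSeries_apply_coeff, PowerSeries.coeff_map]

theorem HahnSeries.exists_nat_of_coeff_subtype_toPuiseux_ne_zero {g : PowerSeries ℚ} {a : ℚ}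
    (h : ((puiseuxSeries (AlgebraicClosure ℚ)).subtype (toPuiseux g)).coeff a ≠ 0) :
    ∃ n : ℕ, a = n ∧ PowerSeries.coeff n g ≠ 0 := by
  by_cases ha : ∃ n : ℕ, a = n
  · obtain ⟨n, rfl⟩ := ha
    rw [HahnSeries.coeff_subtype_toPuiseux] at h
    exact ⟨n, rfl, fun h0 => h (by rw [h0, map_zero])⟩
  · push Not at ha
    exact absurd (HahnSeries.coeff_ofPowerSeries_of_ne _ ha) h

theorem planeSupport_toTwoVariables (F : Polynomial (PowerSeries ℚ)) :
    (toTwoVariables F).planeSupport =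
      ((F.map toPuiseux).map (puiseuxSeries (AlgebraicClosure ℚ)).subtype).hahnSupport := by
  ext ⟨j, k⟩
  simp only [MvPowerSeries.planeSupport, Polynomial.hahnSupport, Set.mem_image, Set.mem_ofPred_eq,
    Polynomial.coeff_map, Prod.mk.injEq]
  constructor
  · rintro ⟨d, hd, rfl, rfl⟩
    rw [HahnSeries.coeff_subtype_toPuiseux]
    exact (map_ne_zero _).2 hd
  · intro h
    obtain ⟨n, rfl, hn⟩ := HahnSeries.exists_nat_of_coeff_subtype_toPuiseux_ne_zero h
    refine ⟨Finsupp.single 0 n + Finsupp.single 1 k, ?_, by simp, by simp⟩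
    change PowerSeries.coeff _ (F.coeff _) ≠ 0
    simpa using hn

theorem toPuiseux_injective : Function.Injective toPuiseux := by
  intro g h hgh
  ext n
  have := congrArg (fun s => ((puiseuxSeries (AlgebraicClosure ℚ)).subtype s).coeff (n : ℚ)) hgh
  simp only [HahnSeries.coeff_subtype_toPuiseux] at this
  exact (algebraMap ℚ (AlgebraicClosure ℚ)).injective this

section Roots

variable {F : Polynomial (PowerSeries ℚ)}

theorem isRoot_of_mem_puiseuxRoots {r : puiseuxSeries (AlgebraicClosure ℚ)}
    (hr : r ∈ puiseuxRoots F) : (F.map toPuiseux).IsRoot r :=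
  Polynomial.isRoot_of_mem_roots hr

theorem ne_zero_of_mem_puiseuxRoots (hF0 : F.coeff 0 ≠ 0)
    {r : puiseuxSeries (AlgebraicClosure ℚ)} (hr : r ∈ puiseuxRoots F) :
    (r : HahnSeries ℚ (AlgebraicClosure ℚ)) ≠ 0 := by
  intro h
  have h0 : r = 0 := Subtype.ext h
  have h1 := isRoot_of_mem_puiseuxRoots hr
  rw [h0, Polynomial.IsRoot, ← Polynomial.coeff_zero_eq_eval_zero, Polynomial.coeff_map] at h1
  exact hF0 (toPuiseux_injective (h1.trans (map_zero _).symm))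

/-- If `r` had order `s ≤ 0`, the leading term of `r ^ m`, of order `m s`, could not cancel in `F(r)
= 0`: a lower term has order at least `1 + i s > m s`, because its coefficient vanishes at `0`. -/
theorem leadingExponent_pos (hF : IsWeierstrassPolynomial F) (hF0 : F.coeff 0 ≠ 0)
    {r : puiseuxSeries (AlgebraicClosure ℚ)} (hr : r ∈ puiseuxRoots F) : 0 < leadingExponent r := by
  have hr0 := ne_zero_of_mem_puiseuxRoots hF0 hr
  set s : HahnSeries ℚ (AlgebraicClosure ℚ) := r.1 with hs
  by_contra! hle
  change s.order ≤ 0 at hle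
  have h1 := isRoot_of_mem_puiseuxRoots hr
  have hm : (F.map toPuiseux).natDegree = F.natDegree := hF.1.natDegree_map _
  rw [Polynomial.IsRoot, Polynomial.eval_eq_sum_range, hm, Finset.sum_range_succ] at h1
  have h2 := congrArg (fun t => ((puiseuxSeries (AlgebraicClosure ℚ)).subtype t).coeff
    (F.natDegree • s.order)) h1
  simp only [map_add, map_sum, map_mul, map_pow, map_zero, Polynomial.coeff_map,
    hF.1.coeff_natDegree, map_one, one_mul, HahnSeries.coeff_add, HahnSeries.coeff_zero,
    HahnSeries.coeff_sum] at h2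
  change _ + (s ^ F.natDegree).coeff _ = 0 at h2
  rw [Finset.sum_eq_zero, zero_add, ← HahnSeries.order_pow, HahnSeries.coeff_order_eq_zero] at h2
  · exact pow_ne_zero _ hr0 h2
  · intro i hi
    rw [Finset.mem_range] at hi
    by_contra hcon
    obtain ⟨x, y, hx, hy, hxy⟩ := HahnSeries.exists_of_coeff_mul_ne_zero hcon
    obtain ⟨k, rfl, hk⟩ := HahnSeries.exists_nat_of_coeff_subtype_toPuiseux_ne_zero hx
    have hk0 : k ≠ 0 := by
      rintro rfl
      exact hk (by simpa using hF.2 i hi)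
    have hk1 : (1 : ℚ) ≤ k := by exact_mod_cast Nat.one_le_iff_ne_zero.2 hk0
    have hy' : i • s.order ≤ y := by
      rw [← HahnSeries.order_pow]
      exact HahnSeries.order_le_of_coeff_ne_zero hy
    have him : (i : ℚ) ≤ F.natDegree := by exact_mod_cast hi.le
    rw [nsmul_eq_mul] at hxy hy'
    nlinarith

theorem map_subtype_eq_prod (hF : F.Monic) :
    (F.map toPuiseux).map (puiseuxSeries (AlgebraicClosure ℚ)).subtype =
      (((puiseuxRoots F).map (puiseuxSeries (AlgebraicClosure ℚ)).subtype).map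
        fun r => Polynomial.X - Polynomial.C r).prod := by
  conv_lhs => rw [(splits_map_toPuiseux hF).eq_prod_roots_of_monic (hF.map _)]
  rw [Polynomial.map_multiset_prod, Multiset.map_map, Multiset.map_map]
  congr 1
  refine Multiset.map_congr rfl fun r _ => ?_
  simp

theorem isStrictMinimizer_toTwoVariables (hF : F.Monic) (hF0 : F.coeff 0 ≠ 0) {w : ℚ}
    (hw : ∀ r ∈ puiseuxRoots F, leadingExponent r ≠ w) :
    IsStrictMinimizer w (toTwoVariables F).planeSupport
      (((puiseuxRoots F).map fun r => if leadingExponent r < w then leadingExponent r else 0).sum,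
        ((puiseuxRoots F).map fun r => if w < leadingExponent r then 1 else 0).sum) := by
  rw [planeSupport_toTwoVariables, map_subtype_eq_prod hF]
  have := isStrictMinimizer_prod_X_sub_C (w := w)
    (s := (puiseuxRoots F).map (puiseuxSeries (AlgebraicClosure ℚ)).subtype) (by
      intro s hs
      obtain ⟨r, hr, rfl⟩ := Multiset.mem_map.1 hs
      exact ⟨ne_zero_of_mem_puiseuxRoots hF0 hr, hw r hr⟩)
  rw [Multiset.map_map (fun r : HahnSeries ℚ (AlgebraicClosure ℚ) =>
      if r.order < w then r.order else 0),
    Multiset.map_map (fun r : HahnSeries ℚ (AlgebraicClosure ℚ) =>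
      if w < r.order then 1 else 0)] at this
  exact this

theorem sum_map_leadingExponent {M : Type*} [AddCommMonoid M] (h : ℚ → M) {n : ℕ} {a : ℕ → ℚ}
    (ha : StrictMonoOn a (Set.Icc 1 n))
    (ha' : a '' Set.Icc 1 n = {q | ∃ r ∈ puiseuxRoots F, leadingExponent r = q}) :
    ((puiseuxRoots F).map fun r => h (leadingExponent r)).sum =
      ∑ μ ∈ Finset.Icc 1 n, numRoots F (a μ) • h (a μ) := by
  have h1 : ((puiseuxRoots F).map leadingExponent).toFinset = (Finset.Icc 1 n).image a := by
    rw [← Finset.coe_inj, Finset.coe_image, Finset.coe_Icc, ha']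
    ext q
    simp
  have h2 := Finset.sum_multiset_map_count ((puiseuxRoots F).map leadingExponent) h
  rw [Multiset.map_map, h1, Finset.sum_image (by
    rw [Finset.coe_Icc]; exact ha.injOn)] at h2
  rw [show (fun r => h (leadingExponent r)) = h ∘ leadingExponent from rfl, h2]
  refine Finset.sum_congr rfl fun μ _ => ?_
  rw [Multiset.count_map, numRoots]
  simp only [eq_comm]

end Roots

/-- Between two consecutive slopes the weight `j + w k` is minimal at a single monomial of `f`. -/
theorem isStrictMinimizer_vertex
    {f U : MvPowerSeries (Fin 2) ℚ} {ν₁ ν₂ : ℕ} {F : Polynomial (PowerSeries ℚ)}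
    (hU : MvPowerSeries.constantCoeff U ≠ 0) (hF : IsWeierstrassPolynomial F)
    (hF0 : F.coeff 0 ≠ 0)
    (hf : f = U * MvPowerSeries.X 0 ^ ν₁ * MvPowerSeries.X 1 ^ ν₂ * toTwoVariables F)
    {n : ℕ} {a : ℕ → ℚ} (ha : StrictMonoOn a (Set.Icc 1 n))
    (ha' : a '' Set.Icc 1 n = {q | ∃ r ∈ puiseuxRoots F, leadingExponent r = q})
    {l : ℕ} (hl : l ≤ n) {w : ℚ} (hw : 0 < w) (hlw : 1 ≤ l → a l < w) (hwl : l < n → w < a (l + 1)) :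
    IsStrictMinimizer w f.planeSupport
      (ν₁ + ∑ μ ∈ Finset.Icc 1 l, a μ * numRoots F (a μ),
        ν₂ + ∑ μ ∈ Finset.Icc (l + 1) n, numRoots F (a μ)) := by
  have hlow : ∀ μ, 1 ≤ μ → μ ≤ l → a μ < w := fun μ h1 h2 =>
    (ha.monotoneOn ⟨h1, h2.trans hl⟩ ⟨h1.trans h2, hl⟩ h2).trans_lt (hlw (h1.trans h2))
  have hhigh : ∀ μ, l + 1 ≤ μ → μ ≤ n → w < a μ := fun μ h1 h2 =>
    (hwl (by omega)).trans_le (ha.monotoneOn ⟨by omega, by omega⟩ ⟨by omega, h2⟩ h1)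
  have hne : ∀ r ∈ puiseuxRoots F, leadingExponent r ≠ w := by
    intro r hr h
    have : w ∈ a '' Set.Icc 1 n := by rw [ha']; exact ⟨r, hr, h⟩
    obtain ⟨μ, ⟨h1, h2⟩, rfl⟩ := this
    rcases le_or_gt μ l with h3 | h3
    · exact (hlow μ h1 h3).false
    · exact (hhigh μ h3 h2).false
  have h1 := (((isStrictMinimizer_of_constantCoeff_ne_zero hw hU).mvPowerSeries_mul
    (isStrictMinimizer_X_pow 0 ν₁)).mvPowerSeries_mul
    (isStrictMinimizer_X_pow 1 ν₂)).mvPowerSeries_mul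
    (isStrictMinimizer_toTwoVariables hF.1 hF0 hne)
  rw [← hf, sum_map_leadingExponent (fun x => if x < w then x else 0) ha ha',
    sum_map_leadingExponent (fun x => if w < x then 1 else 0) ha ha'] at h1
  convert h1 using 1
  ext
  · simp only [Prod.fst_add, zero_add]
    simp only [Finsupp.single_apply, if_true, one_ne_zero, if_false, Nat.cast_zero, add_zero]
    congr 1
    rw [← Finset.sum_subset (Finset.Icc_subset_Icc_right hl)]
    · refine Finset.sum_congr rfl fun μ hμ => ?_
      rw [Finset.mem_Icc] at hμ
      rw [if_pos (hlow μ hμ.1 hμ.2), nsmul_eq_mul, mul_comm]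
    · intro μ hμ hμ'
      rw [Finset.mem_Icc] at hμ hμ'
      rw [if_neg (hhigh μ (by omega) hμ.2).not_gt, smul_zero]
  · simp only [Prod.snd_add, zero_add]
    simp only [Finsupp.single_apply, if_true, zero_ne_one, if_false, zero_add]
    congr 1
    rw [← Finset.sum_subset (Finset.Icc_subset_Icc_left (Nat.le_add_left 1 l))]
    · refine Finset.sum_congr rfl fun μ hμ => ?_
      rw [Finset.mem_Icc] at hμ
      rw [if_pos (hhigh μ hμ.1 hμ.2), smul_eq_mul, mul_one]
    · intro μ hμ hμ'
      rw [Finset.mem_Icc] at hμ hμ'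
      rw [if_neg (hlow μ hμ.1 (by omega)).not_gt, smul_zero]

/-! ### Extreme points of hulls of quadrants -/

/-- The convex hull of the closed quadrants with corners in `S`. -/
def quadrantHull (S : Set (ℝ × ℝ)) : Set (ℝ × ℝ) :=
  convexHull ℝ (⋃ s ∈ S, {t | s.1 ≤ t.1 ∧ s.2 ≤ t.2})

theorem mem_quadrantHull {S : Set (ℝ × ℝ)} {s t : ℝ × ℝ} (hs : s ∈ S) (h1 : s.1 ≤ t.1)
    (h2 : s.2 ≤ t.2) : t ∈ quadrantHull S :=
  subset_convexHull ℝ _ (Set.mem_biUnion hs ⟨h1, h2⟩)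

/-- The point `p` together with the open half-plane of larger weight is convex and, as `w > 0`,
contains all the quadrants; `p` is extreme in it. -/
theorem mem_extremePoints_quadrantHull {S : Set (ℝ × ℝ)} {p : ℝ × ℝ} (hp : p ∈ S) {w : ℝ}
    (hw : 0 < w) (h : ∀ s ∈ S, s ≠ p → p.1 + w * p.2 < s.1 + w * s.2) :
    p ∈ (quadrantHull S).extremePoints ℝ := by
  have key : ∀ x y : ℝ × ℝ, (x = p ∨ p.1 + w * p.2 < x.1 + w * x.2) →
      (y = p ∨ p.1 + w * p.2 < y.1 + w * y.2) → ∀ α β : ℝ, 0 < α → 0 < β → α + β = 1 →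
      (x = p ∧ y = p) ∨ p.1 + w * p.2 < (α • x + β • y).1 + w * (α • x + β • y).2 := by
    intro x y hx hy α β hα hβ hαβ
    have h1 : (α • x + β • y).1 + w * (α • x + β • y).2 =
        α * (x.1 + w * x.2) + β * (y.1 + w * y.2) := by
      simp only [Prod.fst_add, Prod.snd_add, Prod.smul_fst, Prod.smul_snd, smul_eq_mul]; ring
    have h2 : p.1 + w * p.2 = α * (p.1 + w * p.2) + β * (p.1 + w * p.2) := by
      rw [← add_mul, hαβ, one_mul]
    rw [h1]
    rcases hx with rfl | hx <;> rcases hy with rfl | hy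
    · exact Or.inl ⟨rfl, rfl⟩
    · right; nlinarith [mul_lt_mul_of_pos_left hy hβ]
    · right; nlinarith [mul_lt_mul_of_pos_left hx hα]
    · right; nlinarith [mul_lt_mul_of_pos_left hx hα, mul_lt_mul_of_pos_left hy hβ]
  have hconv : Convex ℝ {t : ℝ × ℝ | t = p ∨ p.1 + w * p.2 < t.1 + w * t.2} := by
    rw [convex_iff_forall_pos]
    intro x hx y hy α β hα hβ hαβ
    rcases key x y hx hy α β hα hβ hαβ with ⟨rfl, rfl⟩ | h
    · left; rw [← add_smul, hαβ, one_smul]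
    · exact Or.inr h
  have hsub : quadrantHull S ⊆ {t : ℝ × ℝ | t = p ∨ p.1 + w * p.2 < t.1 + w * t.2} := by
    refine convexHull_min ?_ hconv
    intro t ht
    simp only [Set.mem_iUnion, exists_prop] at ht
    obtain ⟨s, hs, h1, h2⟩ := ht
    have h3 : w * s.2 ≤ w * t.2 := mul_le_mul_of_nonneg_left h2 hw.le
    by_cases hsp : s = p
    · subst hsp
      by_cases hts : t = s
      · exact Or.inl hts
      · right
        rcases h1.lt_or_eq with h1 | h1
        · linarith
        · rcases h2.lt_or_eq with h2 | h2
          · have := mul_lt_mul_of_pos_left h2 hw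
            linarith
          · exact absurd (Prod.ext h1.symm h2.symm) hts
    · right
      linarith [h s hs hsp]
  refine ⟨mem_quadrantHull hp le_rfl le_rfl, ?_⟩
  rintro x hx y hy ⟨α, β, hα, hβ, hαβ, hxy⟩
  rcases key x y (hsub hx) (hsub hy) α β hα hβ hαβ with h | h
  · exact h.1
  · rw [hxy] at h
    exact absurd h (lt_irrefl _)

/-- An extreme point `t` lies in the quadrant of some corner `s`, and it is the midpoint of `s` and
`2 t - s`, both in that quadrant; hence `t = s`. -/
theorem extremePoints_quadrantHull_subset (S : Set (ℝ × ℝ)) :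
    (quadrantHull S).extremePoints ℝ ⊆ S := by
  intro t ht
  have h1 := extremePoints_convexHull_subset ht
  simp only [Set.mem_iUnion, exists_prop] at h1
  obtain ⟨s, hs, h1, h2⟩ := h1
  have h3 : s = t := by
    refine ht.2 (mem_quadrantHull hs le_rfl le_rfl)
      (mem_quadrantHull hs (t := (2 : ℝ) • t - s) ?_ ?_)
      ⟨1 / 2, 1 / 2, by norm_num, by norm_num, by norm_num, ?_⟩
    · simp only [Prod.fst_sub, Prod.smul_fst, smul_eq_mul]; linarith
    · simp only [Prod.snd_sub, Prod.smul_snd, smul_eq_mul]; linarith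
    · ext
      · simp only [Prod.fst_add, Prod.fst_sub, Prod.smul_fst, smul_eq_mul]; ring
      · simp only [Prod.snd_add, Prod.snd_sub, Prod.smul_snd, smul_eq_mul]; ring
  exact h3 ▸ hs

theorem quadrantHull_mono {S T : Set (ℝ × ℝ)} (h : S ⊆ T) : quadrantHull S ⊆ quadrantHull T :=
  convexHull_mono (Set.biUnion_subset_biUnion_left h)

/-- A point above the broken line through the points `(A l, B l)` lies in the hull of the
quadrants at these points. -/
theorem mem_quadrantHull_of_le {n : ℕ} {a A B : ℕ → ℝ} {t : ℝ × ℝ} (h0 : A 0 ≤ t.1)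
    (hn : B n ≤ t.2)
    (hedge : ∀ l < n, A (l + 1) + a (l + 1) * B (l + 1) = A l + a (l + 1) * B l)
    (ht : ∀ l < n, A l + a (l + 1) * B l ≤ t.1 + a (l + 1) * t.2) :
    t ∈ quadrantHull ((fun l => (A l, B l)) '' Set.Icc 0 n) := by
  classical
  -- Take the first vertex not above `t`. Unless it is the vertex of index `0`, the height of `t`
  -- lies between those of consecutive vertices: `θ` picks the point of the edge at that height and
  -- `δ` is the horizontal distance from it to `t`.
  have hex : ∃ l, B l ≤ t.2 := ⟨n, hn⟩
  have hle : Nat.find hex ≤ n := Nat.find_min' hex hn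
  have hspec := Nat.find_spec hex
  have hmin : ∀ m < Nat.find hex, t.2 < B m := fun m hm => not_le.1 (Nat.find_min hex hm)
  generalize Nat.find hex = k at *
  rcases k with _ | l
  · exact mem_quadrantHull ⟨0, by simp, rfl⟩ h0 hspec
  have hl := hmin l (Nat.lt_succ_self l)
  have hpos : 0 < B l - B (l + 1) := by linarith
  set θ := (t.2 - B (l + 1)) / (B l - B (l + 1)) with hθ
  have hθ0 : 0 ≤ θ := div_nonneg (by linarith) hpos.le
  have hθ1 : θ ≤ 1 := by rw [hθ, div_le_one hpos]; linarith
  have hθ2 : θ * (B l - B (l + 1)) = t.2 - B (l + 1) := div_mul_cancel₀ _ hpos.ne'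
  set δ := t.1 - (θ * A l + (1 - θ) * A (l + 1)) with hδ
  have h1 := hedge l (by omega)
  have h2 := ht l (by omega)
  have hδ0 : 0 ≤ δ := by
    have h3 : θ * A l + (1 - θ) * A (l + 1) = A l + a (l + 1) * B l - a (l + 1) * t.2 := by
      have h4 : t.2 = θ * (B l - B (l + 1)) + B (l + 1) := by linarith
      rw [h4]
      linear_combination (1 - θ) * h1
    rw [hδ, h3]
    linarith
  have hx : (A l + δ, B l) ∈ quadrantHull ((fun l => (A l, B l)) '' Set.Icc 0 n) :=
    mem_quadrantHull (s := (A l, B l)) ⟨l, ⟨Nat.zero_le _, by omega⟩, rfl⟩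
      (le_add_of_nonneg_right hδ0) le_rfl
  have hy : (A (l + 1) + δ, B (l + 1)) ∈ quadrantHull ((fun l => (A l, B l)) '' Set.Icc 0 n) :=
    mem_quadrantHull (s := (A (l + 1), B (l + 1))) ⟨l + 1, ⟨Nat.zero_le _, by omega⟩, rfl⟩
      (le_add_of_nonneg_right hδ0) le_rfl
  have heq : t = θ • (A l + δ, B l) + (1 - θ) • (A (l + 1) + δ, B (l + 1)) := by
    refine Prod.ext ?_ ?_
    · simp only [Prod.fst_add, Prod.smul_fst, smul_eq_mul, hδ]; ring
    · simp only [Prod.snd_add, Prod.smul_snd, smul_eq_mul]; linarith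
  rw [heq]
  exact convex_convexHull ℝ _ hx hy hθ0 (sub_nonneg.2 hθ1) (by ring)

theorem extremePoints_quadrantHull_eq {S : Set (ℝ × ℝ)} {n : ℕ} {a A B : ℕ → ℝ}
    (hmem : ∀ l ≤ n, (A l, B l) ∈ S)
    (hmin : ∀ l ≤ n, ∃ w, 0 < w ∧ ∀ s ∈ S, s ≠ (A l, B l) → A l + w * B l < s.1 + w * s.2)
    (h0 : ∀ s ∈ S, A 0 ≤ s.1) (hn : ∀ s ∈ S, B n ≤ s.2) (ha : ∀ l < n, 0 ≤ a (l + 1))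
    (hedge : ∀ l < n, A (l + 1) + a (l + 1) * B (l + 1) = A l + a (l + 1) * B l)
    (hS : ∀ l < n, ∀ s ∈ S, A l + a (l + 1) * B l ≤ s.1 + a (l + 1) * s.2) :
    (quadrantHull S).extremePoints ℝ = (fun l => (A l, B l)) '' Set.Icc 0 n := by
  have hsub : quadrantHull S ⊆ quadrantHull ((fun l => (A l, B l)) '' Set.Icc 0 n) := by
    refine convexHull_min ?_ (convex_convexHull ℝ _)
    intro t ht
    simp only [Set.mem_iUnion, exists_prop] at ht
    obtain ⟨s, hs, h1, h2⟩ := ht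
    refine mem_quadrantHull_of_le ((h0 s hs).trans h1) ((hn s hs).trans h2) hedge fun l hl => ?_
    have := mul_le_mul_of_nonneg_left h2 (ha l hl)
    linarith [hS l hl s hs]
  have hsup : (fun l => (A l, B l)) '' Set.Icc 0 n ⊆ S := by
    rintro _ ⟨l, hl, rfl⟩
    exact hmem l hl.2
  have heq : quadrantHull S = quadrantHull ((fun l => (A l, B l)) '' Set.Icc 0 n) :=
    hsub.antisymm (quadrantHull_mono hsup)
  refine Set.Subset.antisymm ?_ ?_
  · rw [heq]
    exact extremePoints_quadrantHull_subset _
  · rintro _ ⟨l, hl, rfl⟩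
    obtain ⟨w, hw, h⟩ := hmin l hl.2
    exact mem_extremePoints_quadrantHull (hmem l hl.2) hw h

/-- Since `f(0, 0) = 0`, excluding the exponent `(0, 0)` removes nothing. -/
theorem newtonPolyhedron_eq_quadrantHull {f : MvPowerSeries (Fin 2) ℚ}
    (hf0 : MvPowerSeries.constantCoeff f = 0) :
    newtonPolyhedron f =
      quadrantHull ((fun p : ℚ × ℕ => ((p.1 : ℝ), (p.2 : ℝ))) '' f.planeSupport) := by
  have h : reducedSupport f = {d | MvPowerSeries.coeff d f ≠ 0} := by
    ext d
    refine ⟨fun h => h.2, fun h => ⟨?_, h⟩⟩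
    rintro rfl
    exact h (by simpa using hf0)
  rw [newtonPolyhedron, quadrantHull, h, MvPowerSeries.planeSupport, Set.image_image,
    Set.biUnion_image]
  simp only [Rat.cast_natCast]

/-! ### Supporting lines and the main theorem -/

theorem nonneg_at_endpoints_of_nonneg_on_Ioo {α β lo hi : ℚ} (hlt : lo < hi)
    (h : ∀ w ∈ Set.Ioo lo hi, 0 ≤ α + β * w) : 0 ≤ α + β * lo ∧ 0 ≤ α + β * hi := by
  have hc : IsClosed {w : ℚ | 0 ≤ α + β * w} := isClosed_le (by fun_prop) (by fun_prop)
  have h1 : Set.Icc lo hi ⊆ {w : ℚ | 0 ≤ α + β * w} := by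
    rw [← closure_Ioo hlt.ne]
    exact hc.closure_subset_iff.2 h
  exact ⟨h1 ⟨le_rfl, hlt.le⟩, h1 ⟨hlt.le, le_rfl⟩⟩

theorem lemma6p3
    (f U : MvPowerSeries (Fin 2) ℚ) (ν₁ ν₂ : ℕ) (F : Polynomial (PowerSeries ℚ))
    (hf0 : MvPowerSeries.constantCoeff f = 0)
    (hU : MvPowerSeries.constantCoeff U ≠ 0)
    (hF : IsWeierstrassPolynomial F)
    (hF0 : F.coeff 0 ≠ 0)
    (hf : f = U * MvPowerSeries.X 0 ^ ν₁ * MvPowerSeries.X 1 ^ ν₂ * toTwoVariables F)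
    (n : ℕ) (a : ℕ → ℚ)
    (ha : StrictMonoOn a (Set.Icc 1 n))
    (ha' : a '' Set.Icc 1 n = {q | ∃ r ∈ puiseuxRoots F, leadingExponent r = q})
    (A : ℕ → ℚ) (hA : ∀ l, A l = ν₁ + ∑ μ ∈ Finset.Icc 1 l, a μ * numRoots F (a μ))
    (B : ℕ → ℕ) (hB : ∀ l, B l = ν₂ + ∑ μ ∈ Finset.Icc (l + 1) n, numRoots F (a μ)) :
    newtonVertices f = (fun l => ((A l : ℝ), (B l : ℝ))) '' Set.Icc 0 n ∧
      Set.InjOn (fun l => ((A l : ℝ), (B l : ℝ))) (Set.Icc 0 n) := by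
  have hroot : ∀ μ, 1 ≤ μ → μ ≤ n → ∃ r ∈ puiseuxRoots F, leadingExponent r = a μ := by
    intro μ h1 h2
    have : a μ ∈ a '' Set.Icc 1 n := ⟨μ, ⟨h1, h2⟩, rfl⟩
    rwa [ha'] at this
  have hapos : ∀ μ, 1 ≤ μ → μ ≤ n → 0 < a μ := by
    intro μ h1 h2
    obtain ⟨r, hr, h⟩ := hroot μ h1 h2
    exact h ▸ leadingExponent_pos hF hF0 hr
  have hN : ∀ μ, 1 ≤ μ → μ ≤ n → 0 < numRoots F (a μ) := by
    intro μ h1 h2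
    obtain ⟨r, hr, h⟩ := hroot μ h1 h2
    exact Multiset.card_pos_iff_exists_mem.2 ⟨r, Multiset.mem_filter.2 ⟨hr, h⟩⟩
  have hAs : ∀ l, A (l + 1) = A l + a (l + 1) * numRoots F (a (l + 1)) := by
    intro l
    rw [hA, hA, Finset.sum_Icc_succ_top (Nat.le_add_left 1 l), add_assoc]
  have hBs : ∀ l < n, B l = B (l + 1) + numRoots F (a (l + 1)) := by
    intro l hl
    have h : Finset.Icc (l + 1) n = insert (l + 1) (Finset.Icc (l + 1 + 1) n) := by
      ext μ
      simp only [Finset.mem_insert, Finset.mem_Icc]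
      omega
    rw [hB, hB, h, Finset.sum_insert (by simp)]
    ring
  have hBanti : StrictAntiOn B (Set.Icc 0 n) := by
    refine strictAntiOn_of_succ_lt Set.ordConnected_Icc fun l _ _ hl => ?_
    rw [Nat.succ_eq_succ, Set.mem_Icc] at hl
    have h1 := hBs l hl.2
    have h2 := hN (l + 1) (by omega) hl.2
    rw [Nat.succ_eq_succ]
    change B (l + 1) < B l
    omega
  refine ⟨?_, fun l hl m hm h => hBanti.injOn hl hm ?_⟩
  swap
  · simpa using congrArg Prod.snd h
  -- Weights in `(lo l, hi l)` select `(A l, B l)`. The lower end for `l = 0` is `0`; for `l = n`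
  -- there is no upper constraint, and `lo n + 1` is an arbitrary bound.
  let lo : ℕ → ℚ := fun l => if 1 ≤ l then a l else 0
  let hi : ℕ → ℚ := fun l => if l < n then a (l + 1) else lo l + 1
  have hlo : ∀ l ≤ n, 0 ≤ lo l := by
    intro l hl
    simp only [lo]
    split_ifs with h
    · exact (hapos l h hl).le
    · exact le_rfl
  have hlohi : ∀ l ≤ n, lo l < hi l := by
    intro l hl
    simp only [hi]
    split_ifs with h
    · simp only [lo]
      split_ifs with h1
      · exact ha ⟨h1, hl⟩ ⟨by omega, h⟩ (Nat.lt_succ_self l)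
      · exact hapos _ (by omega) h
    · exact lt_add_one _
  have hmin : ∀ l ≤ n, ∀ w, lo l < w → (l < n → w < a (l + 1)) →
      IsStrictMinimizer w f.planeSupport (A l, B l) := by
    intro l hl w h1 h2
    rw [hA, hB]
    refine isStrictMinimizer_vertex hU hF hF0 hf ha ha' hl ((hlo l hl).trans_lt h1) ?_ h2
    intro h
    simpa [lo, h] using h1
  have hle : ∀ l ≤ n, ∀ w, lo l < w → (l < n → w < a (l + 1)) → ∀ s ∈ f.planeSupport,
      0 ≤ (s.1 - A l) + ((s.2 : ℚ) - B l) * w := by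
    intro l hl w h1 h2 s hs
    by_cases h : s = (A l, B l)
    · simp [h]
    · have := (hmin l hl w h1 h2).2 s hs h
      simp only at this
      linarith
  have hend : ∀ l ≤ n, ∀ s ∈ f.planeSupport, 0 ≤ (s.1 - A l) + ((s.2 : ℚ) - B l) * lo l ∧
      0 ≤ (s.1 - A l) + ((s.2 : ℚ) - B l) * hi l := fun l hl s hs =>
    nonneg_at_endpoints_of_nonneg_on_Ioo (hlohi l hl) fun w hw =>
      hle l hl w hw.1 (fun h => by simpa [hi, h] using hw.2) s hs
  rw [newtonVertices, newtonPolyhedron_eq_quadrantHull hf0]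
  refine extremePoints_quadrantHull_eq (a := fun μ => (a μ : ℝ)) (A := fun l => (A l : ℝ))
    (B := fun l => (B l : ℝ)) ?_ ?_ ?_ ?_ ?_ ?_ ?_
  · intro l hl
    obtain ⟨w, h1, h2⟩ := exists_between (hlohi l hl)
    exact ⟨(A l, B l), (hmin l hl w h1 fun h => by simpa [hi, h] using h2).1, rfl⟩
  · intro l hl
    obtain ⟨w, h1, h2⟩ := exists_between (hlohi l hl)
    refine ⟨w, by exact_mod_cast (hlo l hl).trans_lt h1, ?_⟩
    rintro _ ⟨s, hs, rfl⟩ hne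
    have := (hmin l hl w h1 fun h => by simpa [hi, h] using h2).2 s hs
      (by rintro rfl; exact hne rfl)
    dsimp only at this ⊢
    exact_mod_cast this
  · rintro _ ⟨s, hs, rfl⟩
    -- At `lo 0 = 0` the weight is the first coordinate alone.
    have := (hend 0 (Nat.zero_le n) s hs).1
    have h : A 0 ≤ s.1 := by simpa [lo] using this
    dsimp only
    exact_mod_cast h
  · rintro _ ⟨s, hs, rfl⟩
    by_contra! hlt
    have hlt' : (s.2 : ℚ) + 1 ≤ B n := by
      have h : s.2 < B n := by dsimp only at hlt; exact_mod_cast hlt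
      exact_mod_cast h
    have h0 := hlo n le_rfl
    -- A weight exceeding `|s.1 - A n|` makes a deficit of at least `1` in the second coordinate
    -- outweigh any gain in the first.
    have h1 := hle n le_rfl (lo n + 1 + |s.1 - A n|)
      (by linarith [abs_nonneg (s.1 - A n)]) (fun h => absurd h (lt_irrefl n)) s hs
    nlinarith [abs_nonneg (s.1 - A n), le_abs_self (s.1 - A n)]
  · intro l hl
    exact_mod_cast (hapos (l + 1) (by omega) hl).le
  · intro l hl
    simp only [hAs l, hBs l hl]
    push_cast
    ring
  · rintro l hl _ ⟨s, hs, rfl⟩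
    have := (hend l hl.le s hs).2
    simp only [hi, hl, if_true] at this
    have h : A l + a (l + 1) * B l ≤ s.1 + a (l + 1) * s.2 := by linarith
    dsimp only
    exact_mod_cast h
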